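/- Let $q$ be a complex number with $0<|q|<1$ and put $(x;q)_\infty=\prod_{n\ge 0}(1-xq^n)$, $(x;q)_n=\prod_{k=0}^{n-1}(1-xq^k)$ and $(x;q)_{-n}=\prod_{k=1}^{n}(1-xq^{-k})^{-1}$ for $n\ge 0$, and $(x_1,\dots,x_m;q)_n=(x_1;q)_n\cdots(x_m;q)_n$. The very-well-poised series are $${}_8W_7[a_1;a_4,\dots,a_8;q,x]=\sum_{n=0}^{\infty}\frac{(a_1,q\sqrt{a_1},-q\sqrt{a_1},a_4,\dots,a_8;q)_n}{(q,\sqrt{a_1},-\sqrt{a_1},a_1q/a_4,\dots,a_1q/a_8;q)_n}\,x^n,$$ $${}_8\psi_8[a;a_3,\dots,a_8;q,x]=\sum_{n=-\infty}^{\infty}\frac{(q\sqrt a,-q\sqrt a,a_3,\dots,a_8;q)_n}{(\sqrt a,-\sqrt a,aq/a_3,\dots,aq/a_8;q)_n}\,x^n,$$ with the principal square root. Proposition. Let $c,d,e$ be nonzero complex numbers and $z=cde/q$, with $|q/z|<1$. Assume that none of $c,d,e,1/z$ is of the form $q^{j}$ with an integer $j\ge 1$, and that $z^2\ne q$. Then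 the series ${}_8W_7[1/z;c/z,d/z,e/z,1/z,z;q,q]$ converges absolutely, the series ${}_8\psi_8[a;\sqrt a,c,d,e,1/z,z;q,q/z]$ converges absolutely for all $a\ne 1$ sufficiently close to $1$, its limit as $a\to 1$ (through complex $a\neq 1$) exists, and $${}_8W_7[1/z;c/z,d/z,e/z,1/z,z;q,q]=\frac{(zq;q)_\infty}{(q/z^2;q)_\infty}\,\frac{(q/z;q)_\infty^3}{(q;q)_\infty^3}\,\lim_{a\to1}{}_8\psi_8[a;\sqrt a,c,d,e,1/z,z;q,q/z].$$ (For $z=1$ the terms with $n\ge1$ of the ${}_8W_7$ series, whose numerators contain the factor $(1;q)_n^3$, are read as $0$.) -/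

import Mathlib

/-!
The identity is the limiting case `a → 1` of Bailey's transformation between two nonterminating
`₈W₇` series. As `a → 1` the terms of order `n` and `-n` of the balanced bilateral series have the
same limit, so that the bilateral series folds onto the unilateral very-well-poised series with
base parameter `1`; its term of order `n ≥ 1` is twice the common limit, because the factor
`(1 - a q^(2n)) / (1 - a) * (a; q)_n / (q; q)_n` tends to `1 + q^n`. Bailey's transformation turns
that series into the `₈W₇` with base parameter `1 / z`: Jackson's terminating summation writes each
of its terms as a finite sum, and once the summations are interchanged the inner series are summed
by Rogers' `₆φ₅` formula, which is itself the limit of Jackson's sum.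
-/

open Filter Topology

noncomputable section

/-- The infinite `q`-shifted factorial `(x; q)_∞ = ∏_{n ≥ 0} (1 - x q ^ n)`. -/
def qPochInf (x q : ℂ) : ℂ := ∏' n : ℕ, (1 - x * q ^ n)

/-- The `q`-shifted factorial `(x; q)_n` of integer order `n`:
`(x; q)_n = (1 - x) (1 - x q) ⋯ (1 - x q ^ (n - 1))` for `n ≥ 0` and
`(x; q)_{-m} = 1 / ((1 - x q ^ (-1)) ⋯ (1 - x q ^ (-m)))` for `m ≥ 1`.
It is the quotient `(x; q)_∞ / (x q ^ n; q)_∞`, see `qPoch_eq_div`; the finite product keeps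
its meaning where this quotient reads `0 / 0`. -/
def qPoch (x q : ℂ) : ℤ → ℂ
  | Int.ofNat n => ∏ k ∈ Finset.range n, (1 - x * q ^ k)
  | Int.negSucc m => (∏ k ∈ Finset.range (m + 1), (1 - x * (q ^ (k + 1))⁻¹))⁻¹

theorem multipliable_qPochInf (x : ℂ) {q : ℂ} (hq : ‖q‖ < 1) :
    Multipliable fun n : ℕ => 1 - x * q ^ n := by
  have h : Summable fun n : ℕ => ‖-(x * q ^ n)‖ := by
    simp only [norm_neg, norm_mul, norm_pow]
    exact (summable_geometric_of_lt_one (norm_nonneg q) hq).mul_left _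
  simpa [sub_eq_add_neg] using multipliable_one_add_of_summable h

theorem qPochInf_split (x : ℂ) {q : ℂ} (hq : ‖q‖ < 1) (n : ℕ) :
    (∏ k ∈ Finset.range n, (1 - x * q ^ k)) * qPochInf (x * q ^ n) q = qPochInf x q := by
  induction n with
  | zero => simp
  | succ n ih =>
    rw [← ih, Finset.prod_range_succ, mul_assoc]
    congr 1
    have h := (multipliable_qPochInf (x * q ^ (n + 1)) hq)
    have h2 : Multipliable fun k : ℕ => (1 - x * q ^ n * q ^ (k + 1)) := by
      refine h.congr fun k => ?_
      ring
    have h3 := tprod_eq_zero_mul' (f := fun k : ℕ => 1 - x * q ^ n * q ^ k) h2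
    unfold qPochInf
    rw [h3, pow_zero, mul_one]
    congr 1
    refine tprod_congr fun k => ?_
    ring

/-- The defining quotient of the `q`-shifted factorial. -/
theorem qPoch_eq_div (x : ℂ) {q : ℂ} (hq0 : q ≠ 0) (hq : ‖q‖ < 1) (n : ℤ)
    (h : qPochInf (x * q ^ n) q ≠ 0) :
    qPoch x q n = qPochInf x q / qPochInf (x * q ^ n) q := by
  rw [eq_div_iff h]
  cases n with
  | ofNat n => simpa [qPoch] using qPochInf_split x hq n
  | negSucc m =>
    have hs := qPochInf_split (x * q ^ (Int.negSucc m)) hq (m + 1)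
    have hx : x * q ^ (Int.negSucc m) * q ^ (m + 1) = x := by
      rw [zpow_negSucc, mul_assoc, inv_mul_cancel₀ (pow_ne_zero _ hq0), mul_one]
    rw [hx] at hs
    have hp : (∏ k ∈ Finset.range (m + 1), (1 - x * (q ^ (k + 1))⁻¹)) =
        ∏ k ∈ Finset.range (m + 1), (1 - x * q ^ (Int.negSucc m) * q ^ k) := by
      rw [← Finset.prod_range_reflect]
      refine Finset.prod_congr rfl fun k hk => ?_
      have hk' : k < m + 1 := Finset.mem_range.mp hk
      have e : m + 1 = (m + 1 - 1 - k + 1) + k := by omega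
      rw [zpow_negSucc]
      congr 1
      rw [mul_assoc]
      congr 1
      conv_rhs => rw [e, pow_add]
      field_simp
    have hne : (∏ k ∈ Finset.range (m + 1), (1 - x * (q ^ (k + 1))⁻¹)) ≠ 0 := by
      intro h0
      rw [hp] at h0
      rw [h0, zero_mul] at hs
      exact h hs.symm
    show (∏ k ∈ Finset.range (m + 1), (1 - x * (q ^ (k + 1))⁻¹))⁻¹ * _ = _
    rw [inv_mul_eq_iff_eq_mul₀ hne, hp, hs]

/-- The multi-parameter factorial `(x₁, …, x_m; q)_n = (x₁; q)_n ⋯ (x_m; q)_n`. -/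
def qPochList (l : List ℂ) (q : ℂ) (n : ℤ) : ℂ := (l.map fun x => qPoch x q n).prod

/-- The `n`-th term of the basic hypergeometric series with upper parameters `as`, lower
parameters `bs`, base `q` and argument `z`. -/
def phiTerm (as bs : List ℂ) (q z : ℂ) (n : ℕ) : ℂ :=
  qPochList as q n / qPochList bs q n * (z ^ n / qPoch q q n)

/-- The `n`-th term of the bilateral basic hypergeometric series with upper parameters `as`,
lower parameters `bs`, base `q` and argument `z`. -/
def psiTerm (as bs : List ℂ) (q z : ℂ) (n : ℤ) : ℂ :=
  qPochList as q n / qPochList bs q n * z ^ n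

/-- The `n`-th term of the very-well-poised series `_{r+1}W_r[a₁; l; q, z]`: the upper parameters
are `a₁, q √a₁, -q √a₁` followed by `l`, and every upper parameter other than `a₁` has a lower
partner with which its product is `a₁ q`. -/
def vwpWTerm (a₁ : ℂ) (l : List ℂ) (q z : ℂ) (n : ℕ) : ℂ :=
  phiTerm (a₁ :: (q * Complex.sqrt a₁) :: (-(q * Complex.sqrt a₁)) :: l)
    (Complex.sqrt a₁ :: (-Complex.sqrt a₁) :: l.map fun x => a₁ * q / x) q z n

/-- The very-well-poised series `_{r+1}W_r[a₁; l; q, z]`, where `l` lists `a₄, …, a_{r+1}`. -/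
def vwpW (a₁ : ℂ) (l : List ℂ) (q z : ℂ) : ℂ := ∑' n : ℕ, vwpWTerm a₁ l q z n

/-- The `n`-th term of the very-well-poised bilateral series `_rψ_r[a; l; q, z]`: the upper
parameters are `q √a, -q √a` followed by `l`, and every upper parameter has a lower partner with
which its product is `a q`. -/
def vwpPsiTerm (a : ℂ) (l : List ℂ) (q z : ℂ) (n : ℤ) : ℂ :=
  psiTerm ((q * Complex.sqrt a) :: (-(q * Complex.sqrt a)) :: l)
    (Complex.sqrt a :: (-Complex.sqrt a) :: l.map fun x => a * q / x) q z n

/-- The very-well-poised bilateral series `_rψ_r[a; l; q, z]`, where `l` lists `a₃, …, a_r`. -/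
def vwpPsi (a : ℂ) (l : List ℂ) (q z : ℂ) : ℂ := ∑' n : ℤ, vwpPsiTerm a l q z n

end

open Finset Asymptotics

section FiniteProducts

/-- The `q`-shifted factorial `(x; q)_n` of natural order, over any commutative ring. -/
def qPochNat {R : Type*} [CommRing R] (x q : R) (n : ℕ) : R := ∏ k ∈ range n, (1 - x * q ^ k)

variable {R : Type*} [CommRing R]

@[simp]
theorem qPochNat_zero (x q : R) : qPochNat x q 0 = 1 := prod_range_zero _

theorem qPochNat_succ (x q : R) (n : ℕ) :
    qPochNat x q (n + 1) = qPochNat x q n * (1 - x * q ^ n) := prod_range_succ _ n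

theorem qPochNat_add (x q : R) (m n : ℕ) :
    qPochNat x q (m + n) = qPochNat x q m * qPochNat (x * q ^ m) q n := by
  simp only [qPochNat, prod_range_add, pow_add, mul_assoc]

theorem qPochNat_succ' (x q : R) (n : ℕ) :
    qPochNat x q (n + 1) = (1 - x) * qPochNat (x * q) q n := by
  rw [add_comm, qPochNat_add]
  simp [qPochNat]

end FiniteProducts

/-- No factor of the shifted factorials `(x; q)_n` vanishes, so that they may stand in a
denominator. -/
def QRegular {R : Type*} [CommRing R] (q x : R) : Prop := ∀ k : ℕ, x * q ^ k ≠ 1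

namespace QRegular

variable {K : Type*} [Field K] {q x : K}

theorem qPochNat_ne_zero (h : QRegular q x) (n : ℕ) : qPochNat x q n ≠ 0 :=
  prod_ne_zero_iff.mpr fun k _ => sub_ne_zero.mpr (h k).symm

theorem one_sub_ne_zero (h : QRegular q x) (n : ℕ) : 1 - x * q ^ n ≠ 0 :=
  sub_ne_zero.mpr (h n).symm

theorem inv_qPochNat (h : QRegular q x) (n : ℕ) :
    (qPochNat x q n)⁻¹ = (1 - x * q ^ n) * (qPochNat x q (n + 1))⁻¹ := by
  rw [qPochNat_succ, mul_inv_rev, mul_inv_cancel_left₀ (h.one_sub_ne_zero n)]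

theorem mul_pow (h : QRegular q x) (n : ℕ) : QRegular q (x * q ^ n) := fun k => by
  rw [mul_assoc, ← pow_add]
  exact h (n + k)

theorem qPochNat_mul_div_qPochNat (h : QRegular q x) (n : ℕ) :
    qPochNat (q * x) q n / qPochNat x q n = (1 - x * q ^ n) / (1 - x) := by
  have h1 : 1 - x ≠ 0 := by simpa using h.one_sub_ne_zero 0
  rw [div_eq_div_iff (h.qPochNat_ne_zero n) h1, mul_comm q x, mul_comm, ← qPochNat_succ',
    qPochNat_succ, mul_comm]

end QRegular

section WellPoised

variable {K : Type*} [Field K]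

/-- The very-well-poised factor `(1 - a q^(2n)) / (1 - a) * (a; q)_n`, with the removable
singularity at `a = 1` removed. -/
def vwpFac (a q : K) : ℕ → K
  | 0 => 1
  | n + 1 => (1 - a * q ^ (2 * (n + 1))) * qPochNat (a * q) q n

/-- The well-poised quotient `∏_y (y; q)_n / (a q / y; q)_n` over the entries `y` of `l`. -/
def wpRatio (a : K) (l : List K) (q : K) (n : ℕ) : K :=
  (l.map fun y => qPochNat y q n / qPochNat (a * q / y) q n).prod

/-- The `n`-th term of the very-well-poised series with parameters `a; l`, base `q` and argument
`x`. It agrees with `vwpWTerm` and keeps its meaning at `a = 1`. -/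
def vwpTerm (a : K) (l : List K) (q x : K) (n : ℕ) : K :=
  vwpFac a q n / qPochNat q q n * wpRatio a l q n * x ^ n

theorem one_sub_mul_vwpFac (a q : K) (n : ℕ) :
    (1 - a) * vwpFac a q n = (1 - a * q ^ (2 * n)) * qPochNat a q n := by
  cases n with
  | zero => simp [vwpFac]
  | succ n => rw [vwpFac, qPochNat_succ']; ring

theorem vwpFac_add_mul_qPochNat (a q : K) (k m : ℕ) :
    vwpFac a q (k + m) * qPochNat (a * q ^ (k + m)) q k =
      qPochNat (a * q) q (2 * k) * vwpFac (a * q ^ (2 * k)) q m := by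
  cases m with
  | zero =>
    cases k with
    | zero => simp [vwpFac]
    | succ k =>
      rw [add_zero, vwpFac, vwpFac, mul_assoc, mul_one,
        show a * q ^ (k + 1) = a * q * q ^ k by ring, ← qPochNat_add,
        show 2 * (k + 1) = k + (k + 1) + 1 by ring, qPochNat_succ]
      ring
  | succ m =>
    rw [← add_assoc, vwpFac, vwpFac, show a * q ^ (k + m + 1) = a * q * q ^ (k + m) by ring,
      show a * q ^ (2 * k) * q = a * q * q ^ (2 * k) by ring, mul_assoc, ← qPochNat_add,
      mul_left_comm, ← qPochNat_add, show k + m + k = 2 * k + m by ring]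
    ring

@[simp]
theorem wpRatio_nil (a q : K) (n : ℕ) : wpRatio a [] q n = 1 := rfl

@[simp]
theorem wpRatio_cons (a y : K) (l : List K) (q : K) (n : ℕ) :
    wpRatio a (y :: l) q n = qPochNat y q n / qPochNat (a * q / y) q n * wpRatio a l q n := by
  simp [wpRatio]

theorem wpRatio_append (a : K) (l l' : List K) (q : K) (n : ℕ) :
    wpRatio a (l ++ l') q n = wpRatio a l q n * wpRatio a l' q n := by
  simp [wpRatio]

theorem wpRatio_mul_prod (a : K) {l : List K} {q : K} (hl : ∀ y ∈ l, QRegular q (a * q / y))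
    (n : ℕ) :
    wpRatio a l q n * (l.map fun y => 1 - y * q ^ n).prod =
      wpRatio a l q (n + 1) * (l.map fun y => 1 - a * q / y * q ^ n).prod := by
  induction l with
  | nil => simp
  | cons y l ih =>
    obtain ⟨hy, hl⟩ := List.forall_mem_cons.mp hl
    simp only [wpRatio_cons, List.map_cons, List.prod_cons, qPochNat_succ y,
      div_eq_mul_inv _ (qPochNat _ _ _)]
    rw [hy.inv_qPochNat n]
    linear_combination (qPochNat y q n * (1 - y * q ^ n) * (1 - a * q / y * q ^ n) *
      (qPochNat (a * q / y) q (n + 1))⁻¹) * ih hl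

end WellPoised

section Jackson

variable {K : Type*} [Field K]

/-- The `k`-th term of the terminating very-well-poised sum of order `n = k + m` with parameters
`b, c, d`, where `a q = b c d s`, evaluated by Jackson's summation. Indexing by `k` and `m = n - k`
avoids the factor `(q^(-n); q)_k`, and the normalization by `(s; q)_n / (a q; q)_n` lets the term
converge as `m → ∞`. -/
def jacksonTerm (a b c d s q : K) (k m : ℕ) : K :=
  vwpTerm a [b, c, d] q s k *
    (qPochNat q q (k + m) * qPochNat s q m * qPochNat (a * s * q ^ (k + m)) q k /
      (qPochNat q q m * qPochNat (a * q) q (k + m + k)))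

/-- The certificate `G` of a creative telescoping proof of Jackson's summation: the term
`T = jacksonTerm` satisfies
`T (k, m + 1) - jacksonStep (k + m) * T (k, m) = G (k - 1, m + 1) - G (k, m)` with
`G (-1, m) = 0`. -/
def jacksonCert (a b c d s q : K) (k m : ℕ) : K :=
  qPochNat (a * q) q k / qPochNat q q k *
    (wpRatio a [b, c, d] q k * ([b, c, d].map fun y => 1 - y * q ^ k).prod) * s ^ (k + 1) *
    (qPochNat q q (k + m) * qPochNat s q m * qPochNat (a * s * q ^ (k + m + 1)) q k /
      (qPochNat q q m * qPochNat (a * q) q (k + m + k + 1))) *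
    (q ^ m * (1 - a * s * q * q ^ (2 * (k + m)))) /
    ([b, c, d].map fun y => 1 - a * q / y * q ^ (k + m)).prod

/-- The ratio of the values of Jackson's sums of orders `n + 1` and `n`. -/
def jacksonStep (a b c d s q : K) (n : ℕ) : K :=
  ([b, c, d].map fun y => 1 - s * y * q ^ n).prod /
    ([b, c, d].map fun y => 1 - a * q / y * q ^ n).prod

/-- The common factor of the four terms of the telescoping relation between the orders `k + m + 1`
and `k + m + 2`; what is left after its removal is the polynomial identity `jackson_poly_succ`. -/
def jacksonUnit (a b c d s q : K) (k m : ℕ) : K :=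
  qPochNat (a * q) q k / qPochNat q q (k + 1) * wpRatio a [b, c, d] q (k + 1) * s ^ (k + 1) *
    (qPochNat q q (k + 1 + m) * qPochNat s q m * qPochNat (a * s * q ^ (k + 1 + m + 1)) q k /
      (qPochNat q q (m + 1) * qPochNat (a * q) q (k + 1 + m + (k + 1) + 1)))

variable {a b c d s q : K}

theorem jackson_poly_succ (b c d s q P Q : K) {A N : K} (hA : A = b * c * d * s)
    (hN : N = q * Q * P) :
    (1 - c * d * s * N) * (1 - b * d * s * N) * (1 - b * c * s * N) *
        ((1 - A * q * Q ^ 2) * (1 - q * N) * (1 - s * P) * (1 - A * s * N * Q)) -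
      (1 - s * b * N) * (1 - s * c * N) * (1 - s * d * N) *
        ((1 - A * q * Q ^ 2) * (1 - A * s * (Q * P)) * (1 - q * P) * (1 - A * q * N * Q)) =
    (1 - A * s * N ^ 2) * P *
      (q * (1 - q * Q) * ((1 - c * d * s * Q) * (1 - b * d * s * Q) * (1 - b * c * s * Q)) *
          (1 - s * P) * (1 - A * q * N * Q) -
        s * (1 - A * Q) * ((1 - b * q * Q) * (1 - c * q * Q) * (1 - d * q * Q)) *
          (1 - q * P) * (1 - A * s * N * Q)) := by
  subst hA hN
  ring

theorem jackson_poly_zero (b c d s P : K) {A : K} (hA : A = b * c * d * s) :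
    (1 - c * d * s * P) * (1 - b * d * s * P) * (1 - b * c * s * P) * (1 - s * P) -
      (1 - s * b * P) * (1 - s * c * P) * (1 - s * d * P) * (1 - A * P) =
    -(s * P * (1 - A * s * P ^ 2) * ((1 - b) * (1 - c) * (1 - d))) := by
  subst hA
  ring

theorem jacksonTerm_succ (hq : QRegular q q) (ha : QRegular q (a * q)) (k m : ℕ) :
    jacksonTerm a b c d s q (k + 1) m = jacksonUnit a b c d s q k m *
      ((1 - a * q * q * (q ^ k) ^ 2) * (1 - a * q * s * (q ^ k * q ^ m)) * (1 - q * q ^ m) *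
        (1 - a * q * q * q ^ (k + 1 + m) * q ^ k)) := by
  rw [jacksonTerm, vwpTerm, vwpFac, jacksonUnit, qPochNat_succ' (a * s * q ^ (k + 1 + m)),
    mul_assoc (a * s), ← pow_succ]
  simp only [div_eq_mul_inv, mul_inv]
  rw [hq.inv_qPochNat m, ha.inv_qPochNat (k + 1 + m + (k + 1))]
  ring

theorem jacksonTerm_succ_succ (k m : ℕ) :
    jacksonTerm a b c d s q (k + 1) (m + 1) = jacksonUnit a b c d s q k m *
      ((1 - a * q * q * (q ^ k) ^ 2) * (1 - q * q ^ (k + 1 + m)) * (1 - s * q ^ m) *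
        (1 - a * q * s * q ^ (k + 1 + m) * q ^ k)) := by
  rw [jacksonTerm, vwpTerm, vwpFac, jacksonUnit, ← add_assoc (k + 1) m 1,
    qPochNat_succ q q (k + 1 + m), qPochNat_succ s q m, qPochNat_succ (a * s * _) q k,
    add_right_comm (k + 1 + m) 1]
  ring

theorem jacksonCert_succ (hq : QRegular q q) (k m : ℕ) :
    jacksonCert a b c d s q (k + 1) m = jacksonUnit a b c d s q k m *
      (s * (1 - a * q * q ^ k) * (1 - q * q ^ m) * (1 - a * q * s * q ^ (k + 1 + m) * q ^ k) *
        q ^ m * (1 - a * q * s * (q ^ (k + 1 + m)) ^ 2) *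
        (([b, c, d].map fun y => 1 - y * q ^ (k + 1)).prod /
          ([b, c, d].map fun y => 1 - a * q / y * q ^ (k + 1 + m)).prod)) := by
  rw [jacksonCert, jacksonUnit, qPochNat_succ (a * q) q k, qPochNat_succ (a * s * _) q k]
  simp only [div_eq_mul_inv, mul_inv]
  rw [hq.inv_qPochNat m]
  ring

theorem jacksonCert_shift (hq : QRegular q q) (ha : QRegular q (a * q))
    (hl : ∀ y ∈ [b, c, d], QRegular q (a * q / y)) (k m : ℕ) :
    jacksonCert a b c d s q k (m + 1) = jacksonUnit a b c d s q k m *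
      (q * (1 - q * q ^ k) * (1 - s * q ^ m) * (1 - a * q * q * q ^ (k + 1 + m) * q ^ k) *
        q ^ m * (1 - a * q * s * (q ^ (k + 1 + m)) ^ 2) *
        (([b, c, d].map fun y => 1 - a * q / y * q ^ k).prod /
          ([b, c, d].map fun y => 1 - a * q / y * q ^ (k + 1 + m)).prod)) := by
  rw [jacksonCert, jacksonUnit, wpRatio_mul_prod a hl, show k + (m + 1) = k + 1 + m by ring,
    qPochNat_succ s q m, show k + 1 + m + k + 1 = k + 1 + m + (k + 1) by ring]
  simp only [div_eq_mul_inv, mul_inv]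
  rw [hq.inv_qPochNat k, ha.inv_qPochNat (k + 1 + m + (k + 1))]
  ring

theorem wellPoised_div_eq (hb : b ≠ 0) (hc : c ≠ 0) (hd : d ≠ 0) (h : a * q = b * c * d * s) :
    a * q / b = c * d * s ∧ a * q / c = b * d * s ∧ a * q / d = b * c * s := by
  refine ⟨?_, ?_, ?_⟩ <;> field_simp <;> rw [h] <;> ring

theorem jackson_telescope_succ (hb : b ≠ 0) (hc : c ≠ 0) (hd : d ≠ 0) (h : a * q = b * c * d * s)
    (hq : QRegular q q) (ha : QRegular q (a * q))
    (hl : ∀ y ∈ [b, c, d], QRegular q (a * q / y)) (k m : ℕ) :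
    jacksonTerm a b c d s q (k + 1) (m + 1) -
        jacksonStep a b c d s q (k + 1 + m) * jacksonTerm a b c d s q (k + 1) m =
      jacksonCert a b c d s q k (m + 1) - jacksonCert a b c d s q (k + 1) m := by
  have hne (y : K) (hy : y ∈ [b, c, d]) := (hl y hy).one_sub_ne_zero (k + 1 + m)
  obtain ⟨eb, ec, ed⟩ := wellPoised_div_eq hb hc hd h
  rw [jacksonTerm_succ_succ, jacksonTerm_succ hq ha, jacksonCert_succ hq,
    jacksonCert_shift hq ha hl, jacksonStep]
  simp only [List.forall_mem_cons, List.map_cons, List.prod_cons, List.map_nil, List.prod_nil,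
    mul_one, eb, ec, ed] at hne ⊢
  obtain ⟨hB, hC, hD, -⟩ := hne
  have hN : q ^ (k + 1 + m) = q * q ^ k * q ^ m := by ring
  rw [pow_succ q k]
  have hpoly := jackson_poly_succ b c d s q (q ^ m) (q ^ k) h hN
  generalize 1 - c * d * s * q ^ (k + 1 + m) = B, 1 - b * d * s * q ^ (k + 1 + m) = C,
    1 - b * c * s * q ^ (k + 1 + m) = D at *
  field_simp
  linear_combination jacksonUnit a b c d s q k m * hpoly

theorem jackson_telescope_zero (hb : b ≠ 0) (hc : c ≠ 0) (hd : d ≠ 0) (h : a * q = b * c * d * s)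
    (hq : QRegular q q) (ha : QRegular q (a * q))
    (hl : ∀ y ∈ [b, c, d], QRegular q (a * q / y)) (m : ℕ) :
    jacksonTerm a b c d s q 0 (m + 1) - jacksonStep a b c d s q m * jacksonTerm a b c d s q 0 m =
      -jacksonCert a b c d s q 0 m := by
  have hne (y : K) (hy : y ∈ [b, c, d]) := (hl y hy).one_sub_ne_zero m
  obtain ⟨eb, ec, ed⟩ := wellPoised_div_eq hb hc hd h
  have := ha.one_sub_ne_zero m
  have := ha.qPochNat_ne_zero m
  have hqm := hq.qPochNat_ne_zero m
  simp only [jacksonTerm, jacksonCert, jacksonStep, vwpTerm, vwpFac, qPochNat_zero, wpRatio,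
    List.forall_mem_cons, List.map_cons, List.prod_cons, List.map_nil, List.prod_nil,
    mul_one, div_one, one_mul, pow_zero, zero_add, add_zero, eb, ec, ed] at hne ⊢
  obtain ⟨hB, hC, hD, -⟩ := hne
  rw [mul_div_mul_left _ _ (hq.qPochNat_ne_zero (m + 1)), mul_div_mul_left _ _ hqm,
    mul_div_mul_left _ _ hqm, pow_mul', qPochNat_succ s, qPochNat_succ (a * q)]
  have hpoly := jackson_poly_zero b c d s (q ^ m) h
  generalize 1 - c * d * s * q ^ m = B, 1 - b * d * s * q ^ m = C, 1 - b * c * s * q ^ m = D,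
    1 - a * q * q ^ m = A at *
  field_simp
  linear_combination qPochNat s q m * hpoly

theorem jacksonTerm_succ_zero (hq : QRegular q q) (ha : QRegular q (a * q))
    (hl : ∀ y ∈ [b, c, d], QRegular q (a * q / y)) (n : ℕ) :
    jacksonTerm a b c d s q (n + 1) 0 = jacksonCert a b c d s q n 0 := by
  have hprod : ([b, c, d].map fun y => 1 - a * q / y * q ^ n).prod ≠ 0 := by
    simp only [List.forall_mem_cons] at hl
    obtain ⟨hB, hC, hD, -⟩ := hl
    simp [hB.one_sub_ne_zero, hC.one_sub_ne_zero, hD.one_sub_ne_zero]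
  rw [jacksonTerm, jacksonCert, vwpTerm, vwpFac, wpRatio_mul_prod a hl, add_zero, add_zero,
    qPochNat_succ (a * s * _) q n, ← add_assoc (n + 1) n 1, add_right_comm n 1 n]
  have := hq.qPochNat_ne_zero n
  have := hq.qPochNat_ne_zero (n + 1)
  generalize ([b, c, d].map fun y => 1 - a * q / y * q ^ n).prod = D at *
  simp only [div_eq_mul_inv, mul_inv]
  rw [ha.inv_qPochNat (n + n + 1)]
  field_simp
  ring

theorem sum_antidiagonal_telescope (G : ℕ → ℕ → K) (n : ℕ) {T : ℕ → ℕ → K}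
    (h0 : ∀ m, T 0 m = -G 0 m) (hsucc : ∀ k m, T (k + 1) m = G k (m + 1) - G (k + 1) m) :
    ∑ p ∈ antidiagonal n, T p.1 p.2 = -G n 0 := by
  cases n with
  | zero => simp [h0]
  | succ n =>
    have h := (Nat.sum_antidiagonal_succ (f := fun p : ℕ × ℕ => G p.1 p.2) (n := n)).symm.trans
      Nat.sum_antidiagonal_succ'
    rw [Nat.sum_antidiagonal_succ]
    simp only [h0, hsucc, sum_sub_distrib]
    linear_combination -h

theorem sum_antidiagonal_jacksonTerm (hb : b ≠ 0) (hc : c ≠ 0) (hd : d ≠ 0)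
    (h : a * q = b * c * d * s) (hq : QRegular q q) (ha : QRegular q (a * q))
    (hl : ∀ y ∈ [b, c, d], QRegular q (a * q / y)) (n : ℕ) :
    ∑ p ∈ antidiagonal n, jacksonTerm a b c d s q p.1 p.2 =
      ([b, c, d].map fun y => qPochNat (s * y) q n / qPochNat (a * q / y) q n).prod := by
  induction n with
  | zero => simp [jacksonTerm, vwpTerm, vwpFac, wpRatio]
  | succ n ih =>
    have htel := sum_antidiagonal_telescope (jacksonCert a b c d s q) n
      (T := fun k m => jacksonTerm a b c d s q k (m + 1) -
        jacksonStep a b c d s q (k + m) * jacksonTerm a b c d s q k m)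
      (fun m => by rw [zero_add]; exact jackson_telescope_zero hb hc hd h hq ha hl m)
      (jackson_telescope_succ hb hc hd h hq ha hl)
    have hsum : ∑ p ∈ antidiagonal n, jacksonStep a b c d s q (p.1 + p.2) *
        jacksonTerm a b c d s q p.1 p.2 = jacksonStep a b c d s q n *
          ∑ p ∈ antidiagonal n, jacksonTerm a b c d s q p.1 p.2 := by
      rw [mul_sum]
      exact sum_congr rfl fun p hp => by rw [mem_antidiagonal.mp hp]
    rw [sum_sub_distrib, hsum, ih] at htel
    have hstep :
        ([b, c, d].map fun y => qPochNat (s * y) q (n + 1) / qPochNat (a * q / y) q (n + 1)).prod =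
        jacksonStep a b c d s q n *
          ([b, c, d].map fun y => qPochNat (s * y) q n / qPochNat (a * q / y) q n).prod := by
      simp only [jacksonStep, List.map_cons, List.prod_cons, List.map_nil, List.prod_nil,
        qPochNat_succ, mul_div_mul_comm]
      ring
    rw [Nat.sum_antidiagonal_succ', jacksonTerm_succ_zero hq ha hl, hstep]
    linear_combination htel

end Jackson

theorem QRegular.of_norm_lt_one {K : Type*} [NormedField K] {q x : K} (hq : ‖q‖ < 1)
    (hx : ‖x‖ < 1) : QRegular q x := fun k h => by
  have := mul_lt_one_of_nonneg_of_lt_one_left (norm_nonneg x) hx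
    (pow_le_one₀ (n := k) (norm_nonneg q) hq.le)
  rw [← norm_pow, ← norm_mul, h, norm_one] at this
  exact this.false

section InfiniteProducts

variable {q : ℂ}

theorem tendsto_qPochNat (x : ℂ) (hq : ‖q‖ < 1) :
    Tendsto (qPochNat x q) atTop (𝓝 (qPochInf x q)) :=
  (multipliable_qPochInf x hq).hasProd.tendsto_prod_nat

theorem qPochInf_eq_mul (x : ℂ) (hq : ‖q‖ < 1) (n : ℕ) :
    qPochInf x q = qPochNat x q n * qPochInf (x * q ^ n) q := (qPochInf_split x hq n).symm

theorem qPochInf_ne_zero {x : ℂ} (hq : ‖q‖ < 1) (h : QRegular q x) : qPochInf x q ≠ 0 := by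
  have hne (n : ℕ) : 1 + -(x * q ^ n) ≠ 0 := by
    rw [← sub_eq_add_neg]
    exact h.one_sub_ne_zero n
  have hs : Summable fun n : ℕ => ‖-(x * q ^ n)‖ := by
    simp only [norm_neg, norm_mul, norm_pow]
    exact (summable_geometric_of_lt_one (norm_nonneg q) hq).mul_left _
  simpa only [qPochInf, sub_eq_add_neg] using tprod_one_add_ne_zero_of_summable hne hs

theorem norm_qPochNat_le (x : ℂ) (hq : ‖q‖ < 1) (n : ℕ) :
    ‖qPochNat x q n‖ ≤ Real.exp (‖x‖ * (1 - ‖q‖)⁻¹) := by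
  have hsum : ∑ k ∈ range n, ‖-(x * q ^ k)‖ ≤ ‖x‖ * (1 - ‖q‖)⁻¹ := by
    simp only [norm_neg, norm_mul, norm_pow, ← mul_sum]
    gcongr
    exact (summable_geometric_of_lt_one (norm_nonneg q) hq).sum_le_tsum _ (fun _ _ => by positivity)
      |>.trans_eq (tsum_geometric_of_lt_one (norm_nonneg q) hq)
  have h := (range n).norm_prod_one_add_sub_one_le fun k => -(x * q ^ k)
  simp only [← sub_eq_add_neg] at h
  have h1 := norm_le_norm_sub_add (qPochNat x q n) 1
  rw [norm_one] at h1
  exact (h1.trans (add_le_of_le_sub_right h)).trans (Real.exp_le_exp.mpr hsum)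

theorem norm_qPochInf_le (x : ℂ) (hq : ‖q‖ < 1) :
    ‖qPochInf x q‖ ≤ Real.exp (‖x‖ * (1 - ‖q‖)⁻¹) :=
  le_of_tendsto (tendsto_qPochNat x hq).norm (Eventually.of_forall (norm_qPochNat_le x hq))

theorem continuous_qPochNat (q : ℂ) (n : ℕ) : Continuous fun x => qPochNat x q n := by
  unfold qPochNat
  fun_prop

theorem continuous_qPochInf (hq : ‖q‖ < 1) : Continuous fun x => qPochInf x q := by
  rw [continuous_iff_continuousAt]
  intro x₀
  have h := tendsto_tprod_one_add_of_dominated_convergence (𝓕 := 𝓝 x₀)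
    (f := fun x (n : ℕ) => -(x * q ^ n)) (g := fun n => -(x₀ * q ^ n))
    (bound := fun n => (‖x₀‖ + 1) * ‖q‖ ^ n)
    ((summable_geometric_of_lt_one (norm_nonneg q) hq).mul_left _)
    (fun n => (Continuous.tendsto (by fun_prop) x₀)) ?_
  · simpa only [ContinuousAt, qPochInf, sub_eq_add_neg] using h
  · filter_upwards [continuous_norm.continuousAt.eventually_lt continuousAt_const
      (lt_add_one ‖x₀‖)] with x hx n
    rw [norm_neg, norm_mul, norm_pow]
    gcongr

end InfiniteProducts

section Bounds

variable {ι : Type*} {L : Filter ι} {q : ℂ}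

theorem isBigO_exp_norm_mul {x : ι → ℂ} (hx : x =O[L] fun _ => (1 : ℝ)) {r : ℝ} (hr : 0 ≤ r) :
    (fun i => Real.exp (‖x i‖ * r)) =O[L] fun _ => (1 : ℝ) := by
  obtain ⟨C, hC⟩ := hx.bound
  refine .of_bound (Real.exp (C * r)) (hC.mono fun i hi => ?_)
  simp only [norm_one, mul_one, Real.norm_eq_abs, Real.abs_exp] at hi ⊢
  gcongr

theorem isBigO_qPochNat {x : ι → ℂ} (hq : ‖q‖ < 1) (hx : x =O[L] fun _ => (1 : ℝ)) (n : ι → ℕ) :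
    (fun i => qPochNat (x i) q (n i)) =O[L] fun _ => (1 : ℝ) :=
  (IsBigO.of_norm_le fun i => norm_qPochNat_le (x i) hq (n i)).trans
    (isBigO_exp_norm_mul hx (inv_nonneg.mpr (sub_nonneg.mpr hq.le)))

theorem isBigO_qPochInf {x : ι → ℂ} (hq : ‖q‖ < 1) (hx : x =O[L] fun _ => (1 : ℝ)) :
    (fun i => qPochInf (x i) q) =O[L] fun _ => (1 : ℝ) :=
  (IsBigO.of_norm_le fun i => norm_qPochInf_le (x i) hq).trans
    (isBigO_exp_norm_mul hx (inv_nonneg.mpr (sub_nonneg.mpr hq.le)))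

theorem isBigO_mul_pow_one {x : ι → ℂ} (hq : ‖q‖ < 1) (hx : x =O[L] fun _ => (1 : ℝ)) (n : ι → ℕ) :
    (fun i => x i * q ^ n i) =O[L] fun _ => (1 : ℝ) :=
  (IsBigO.of_norm_le fun i => by
    rw [norm_mul, norm_pow]
    exact mul_le_of_le_one_right (norm_nonneg _) (pow_le_one₀ (norm_nonneg q) hq.le)).trans
      hx.norm_left

theorem isBigO_inv_qPochNat {x : ι → ℂ} {x₀ : ℂ} (hq : ‖q‖ < 1) (hx : Tendsto x L (𝓝 x₀))
    (h : QRegular q x₀) (n : ι → ℕ) :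
    (fun i => (qPochNat (x i) q (n i))⁻¹) =O[L] fun _ => (1 : ℝ) := by
  have hinf : Tendsto (fun i => qPochInf (x i) q) L (𝓝 (qPochInf x₀ q)) :=
    ((continuous_qPochInf hq).tendsto x₀).comp hx
  have hinv := (hinf.inv₀ (qPochInf_ne_zero hq h)).isBigO_one ℝ
  have hshift := isBigO_qPochInf hq (isBigO_mul_pow_one hq (hx.isBigO_one ℝ) n)
  have hquot := hshift.mul hinv
  rw [mul_one] at hquot
  refine hquot.congr' ?_ .rfl
  filter_upwards [hinf.eventually_ne (qPochInf_ne_zero hq h)] with i hi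
  rw [qPochInf_eq_mul (x i) hq (n i)] at hi ⊢
  rw [mul_inv, mul_left_comm, mul_inv_cancel₀ (right_ne_zero_of_mul hi), mul_one]

theorem isBigO_vwpFac {a : ι → ℂ} (hq : ‖q‖ < 1) (ha : a =O[L] fun _ => (1 : ℝ)) (n : ι → ℕ) :
    (fun i => vwpFac (a i) q (n i)) =O[L] fun _ => (1 : ℝ) := by
  have hone : (fun _ : ι => (1 : ℂ)) =O[L] fun _ => (1 : ℝ) := isBigO_const_one ℝ 1 L
  have hlin := hone.sub (isBigO_mul_pow_one hq ha fun i => 2 * n i)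
  have hpoch := isBigO_qPochNat hq (isBigO_mul_pow_one hq ha fun _ => 1) fun i => n i - 1
  have hmul := hlin.mul hpoch
  rw [mul_one] at hmul
  refine (IsBigO.of_norm_le fun i => ?_).trans (hone.norm_left.add hmul.norm_left)
  cases h : n i with
  | zero => simp [vwpFac]
  | succ k => simp [vwpFac]

theorem isBigO_wpRatio {a : ι → ℂ} {l : List (ι → ℂ)} (hq : ‖q‖ < 1)
    (hl : ∀ y ∈ l, y =O[L] fun _ => (1 : ℝ))
    (hreg : ∀ y ∈ l, ∃ x₀, Tendsto (fun i => a i * q / y i) L (𝓝 x₀) ∧ QRegular q x₀) (n : ι → ℕ) :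
    (fun i => wpRatio (a i) (l.map fun y => y i) q (n i)) =O[L] fun _ => (1 : ℝ) := by
  induction l with
  | nil => simpa using isBigO_const_one ℝ (1 : ℂ) L
  | cons y l ih =>
    rw [List.forall_mem_cons] at hl hreg
    obtain ⟨⟨x₀, hx₀, hy⟩, hreg⟩ := hreg
    have h := ((isBigO_qPochNat hq hl.1 n).mul (isBigO_inv_qPochNat hq hx₀ hy n)).mul (ih hl.2 hreg)
    simpa only [List.map_cons, wpRatio_cons, div_eq_mul_inv, mul_one] using h

end Bounds

section Rogers

variable {q : ℂ}

theorem isBigO_wpRatio_const {ι : Type*} {L : Filter ι} {a : ℂ} {l : List ℂ} (hq : ‖q‖ < 1)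
    (hl : ∀ y ∈ l, QRegular q (a * q / y)) (n : ι → ℕ) :
    (fun i => wpRatio a l q (n i)) =O[L] fun _ => (1 : ℝ) := by
  have h := isBigO_wpRatio (L := L) (a := fun _ => a) (l := l.map fun y _ => y) hq
    (by simpa using fun y _ => isBigO_const_one ℝ y L)
    (by simpa using fun y hy => ⟨_, tendsto_const_nhds, hl y hy⟩) n
  simpa [List.map_map, Function.comp_def] using h

theorem isBigO_vwpTerm {ι : Type*} {L : Filter ι} {a : ℂ} {l : List ℂ} (hq : ‖q‖ < 1)
    (hl : ∀ y ∈ l, QRegular q (a * q / y)) (x : ℂ) (n : ι → ℕ) :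
    (fun i => vwpTerm a l q x (n i)) =O[L] fun i => ‖x‖ ^ n i := by
  have h := (((isBigO_vwpFac hq (isBigO_const_one ℝ a L) n).mul
    (isBigO_inv_qPochNat hq tendsto_const_nhds (.of_norm_lt_one hq hq) n)).mul
    (isBigO_wpRatio_const hq hl n)).mul (isBigO_refl (fun i => x ^ n i) L).norm_right
  simpa only [one_mul, norm_pow, vwpTerm, div_eq_mul_inv] using h

theorem summable_vwpTerm {a x : ℂ} {l : List ℂ} (hq : ‖q‖ < 1)
    (hl : ∀ y ∈ l, QRegular q (a * q / y)) (hx : ‖x‖ < 1) : Summable (vwpTerm a l q x) :=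
  summable_of_isBigO_nat (summable_geometric_of_lt_one (norm_nonneg x) hx)
    (isBigO_vwpTerm hq hl x id)

variable {a b c d s : ℂ}

theorem isBigO_jacksonTerm (hq : ‖q‖ < 1) (ha : QRegular q (a * q))
    (hl : ∀ y ∈ [b, c, d], QRegular q (a * q / y)) :
    (fun p : ℕ × ℕ => jacksonTerm a b c d s q p.1 p.2) =O[⊤] fun p => ‖s‖ ^ p.1 := by
  have hqq : QRegular q q := .of_norm_lt_one hq hq
  have hnum := ((isBigO_qPochNat (L := ⊤) hq (isBigO_const_one ℝ q _)
      fun p : ℕ × ℕ => p.1 + p.2).mul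
    (isBigO_qPochNat hq (isBigO_const_one ℝ s _) fun p => p.2)).mul
    (isBigO_qPochNat hq (isBigO_mul_pow_one hq (isBigO_const_one ℝ (a * s) _) fun p => p.1 + p.2)
      fun p => p.1)
  have hden := (isBigO_inv_qPochNat hq tendsto_const_nhds hqq fun p : ℕ × ℕ => p.2).mul
    (isBigO_inv_qPochNat (L := ⊤) hq tendsto_const_nhds ha fun p => p.1 + p.2 + p.1)
  simpa only [jacksonTerm, div_eq_mul_inv, mul_inv, mul_one] using
    (isBigO_vwpTerm hq hl s fun p : ℕ × ℕ => p.1).mul (hnum.mul hden)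

theorem tendsto_jacksonTerm (hq : ‖q‖ < 1) (ha : QRegular q (a * q)) (k : ℕ) :
    Tendsto (fun m => jacksonTerm a b c d s q k m) atTop
      (𝓝 (vwpTerm a [b, c, d] q s k * (qPochInf s q / qPochInf (a * q) q))) := by
  have hqq : QRegular q q := .of_norm_lt_one hq hq
  have hne := mul_ne_zero (qPochInf_ne_zero hq hqq) (qPochInf_ne_zero hq ha)
  have hadd : Tendsto (fun m => k + m) atTop atTop :=
    tendsto_atTop_mono (fun m => m.le_add_left k) tendsto_id
  have hadd' : Tendsto (fun m => k + m + k) atTop atTop :=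
    tendsto_atTop_mono (fun m => (m.le_add_left k).trans (Nat.le_add_right _ k)) tendsto_id
  have hshift : Tendsto (fun m => qPochNat (a * s * q ^ (k + m)) q k) atTop (𝓝 1) := by
    have h0 : Tendsto (fun m => a * s * q ^ (k + m)) atTop (𝓝 0) := by
      simpa using ((tendsto_pow_atTop_nhds_zero_of_norm_lt_one hq).comp hadd).const_mul (a * s)
    have hzero : qPochNat 0 q k = 1 := by simp [qPochNat]
    exact hzero ▸ ((continuous_qPochNat q k).tendsto 0).comp h0
  have h := ((((tendsto_qPochNat q hq).comp hadd).mul (tendsto_qPochNat s hq)).mul hshift).div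
    ((tendsto_qPochNat q hq).mul ((tendsto_qPochNat (a * q) hq).comp hadd')) hne
  rw [mul_one, mul_div_mul_left _ _ (qPochInf_ne_zero hq hqq)] at h
  exact h.const_mul _

theorem tendsto_sum_antidiagonal_jacksonTerm (hq : ‖q‖ < 1) (hs : ‖s‖ < 1) (ha : QRegular q (a * q))
    (hl : ∀ y ∈ [b, c, d], QRegular q (a * q / y)) :
    Tendsto (fun n => ∑ p ∈ antidiagonal n, jacksonTerm a b c d s q p.1 p.2) atTop
      (𝓝 ((∑' k, vwpTerm a [b, c, d] q s k) * (qPochInf s q / qPochInf (a * q) q))) := by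
  obtain ⟨C, hC⟩ := (isBigO_jacksonTerm (s := s) hq ha hl).bound
  rw [eventually_top] at hC
  have hC0 : 0 ≤ C := by simpa using (norm_nonneg _).trans (hC (0, 0))
  rw [← tsum_mul_right]
  refine (tendsto_tsum_of_dominated_convergence (𝓕 := atTop)
    (f := fun n k => if k ≤ n then jacksonTerm a b c d s q k (n - k) else 0)
    (bound := fun k => C * ‖s‖ ^ k)
    ((summable_geometric_of_lt_one (norm_nonneg s) hs).mul_left C)
    (fun k => ((tendsto_jacksonTerm hq ha k).comp (tendsto_sub_atTop_nat k)).congr' ?_)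
    (.of_forall fun n k => ?_)).congr fun n => ?_
  · filter_upwards [eventually_ge_atTop k] with n hn using (if_pos hn).symm
  · split_ifs
    · simpa using hC (k, n - k)
    · rw [norm_zero]
      positivity
  · rw [Nat.sum_antidiagonal_eq_sum_range_succ (jacksonTerm a b c d s q),
      tsum_eq_sum (s := range n.succ) fun k hk => if_neg (by simpa using hk)]
    exact sum_congr rfl fun k hk => if_pos (Nat.lt_succ_iff.mp (mem_range.mp hk))

theorem tsum_vwpTerm_three (hb : b ≠ 0) (hc : c ≠ 0) (hd : d ≠ 0) (h : a * q = b * c * d * s)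
    (hq : ‖q‖ < 1) (hs : ‖s‖ < 1) (ha : QRegular q (a * q))
    (hl : ∀ y ∈ [b, c, d], QRegular q (a * q / y)) :
    ∑' k, vwpTerm a [b, c, d] q s k = qPochInf (a * q) q / qPochInf s q *
      ([b, c, d].map fun y => qPochInf (s * y) q / qPochInf (a * q / y) q).prod := by
  have hprod : Tendsto
      (fun n => ([b, c, d].map fun y => qPochNat (s * y) q n / qPochNat (a * q / y) q n).prod) atTop
      (𝓝 ([b, c, d].map fun y => qPochInf (s * y) q / qPochInf (a * q / y) q).prod) :=
    tendsto_list_prod _ fun y hy =>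
      (tendsto_qPochNat _ hq).div (tendsto_qPochNat _ hq) (qPochInf_ne_zero hq (hl y hy))
  have hsum := tendsto_nhds_unique (hprod.congr fun n =>
    (sum_antidiagonal_jacksonTerm hb hc hd h (.of_norm_lt_one hq hq) ha hl n).symm)
    (tendsto_sum_antidiagonal_jacksonTerm hq hs ha hl)
  have ha0 := qPochInf_ne_zero hq ha
  have hs0 := qPochInf_ne_zero hq (.of_norm_lt_one hq hs)
  rw [hsum]
  field_simp

end Rogers

section Bailey

/-- The double series behind Bailey's transformation: its sums over the antidiagonals are, by
Jackson's summation, the terms of the series with base parameter `a * s`, and its row sums are, by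
Rogers' summation, multiples of those of the series with base parameter `a`. -/
def baileyTerm {K : Type*} [Field K] (a b c d e f s q x : K) (k m : ℕ) : K :=
  vwpTerm (a * s) [e, f] q x (k + m) * jacksonTerm a b c d s q k m

theorem wpRatio_add {K : Type*} [Field K] {q : K} (hq : q ≠ 0) (a : K) (l : List K) (k m : ℕ) :
    wpRatio a l q (k + m) =
      wpRatio a l q k * wpRatio (a * q ^ (2 * k)) (l.map (· * q ^ k)) q m := by
  induction l with
  | nil => simp
  | cons y l ih =>
    have hy : a * q ^ (2 * k) * q / (y * q ^ k) = a * q / y * q ^ k := by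
      rw [two_mul, pow_add]
      field_simp
    rw [List.map_cons, wpRatio_cons, wpRatio_cons, wpRatio_cons, ih, qPochNat_add, qPochNat_add, hy]
    ring

theorem baileyTerm_eq_mul_vwpTerm {K : Type*} [Field K] {a b c d e f s q x : K} (hq0 : q ≠ 0)
    (hs : s ≠ 0) (hq : QRegular q q) (k m : ℕ) :
    baileyTerm a b c d e f s q x k m =
      vwpTerm a [b, c, d] q s k * x ^ k * wpRatio (a * s) [e, f] q k *
        (qPochNat (a * s * q) q (2 * k) / qPochNat (a * q) q (2 * k)) *
        vwpTerm (a * s * q ^ (2 * k)) [e * q ^ k, f * q ^ k, s] q x m := by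
  have hratio : wpRatio (a * s * q ^ (2 * k)) [e * q ^ k, f * q ^ k, s] q m =
      wpRatio (a * s * q ^ (2 * k)) [e * q ^ k, f * q ^ k] q m *
        (qPochNat s q m / qPochNat (a * q * q ^ (2 * k)) q m) := by
    rw [show a * q * q ^ (2 * k) = a * s * q ^ (2 * k) * q / s by field_simp]
    simp only [wpRatio_cons, wpRatio_nil, mul_one, mul_assoc]
  have hcancel := inv_mul_cancel₀ (hq.qPochNat_ne_zero (k + m))
  have hfac := vwpFac_add_mul_qPochNat (a * s) q k m
  rw [baileyTerm, jacksonTerm, show k + m + k = 2 * k + m by ring, qPochNat_add (a * q)]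
  generalize vwpTerm a [b, c, d] q s k = V
  simp only [vwpTerm, hratio, wpRatio_add hq0 (a * s) [e, f], List.map_cons, List.map_nil]
  generalize wpRatio (a * s) [e, f] q k = R,
    wpRatio (a * s * q ^ (2 * k)) [e * q ^ k, f * q ^ k] q m = R'
  simp only [div_eq_mul_inv, mul_inv]
  generalize (qPochNat q q m)⁻¹ = M, (qPochNat (a * q) q (2 * k))⁻¹ = N,
    (qPochNat (a * q * q ^ (2 * k)) q m)⁻¹ = P, qPochNat s q m = S at *
  linear_combination
    (vwpFac (a * s) q (k + m) * qPochNat (a * s * q ^ (k + m)) q k *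
        (R * R' * x ^ (k + m) * V * S * M * N * P)) * hcancel +
      R * R' * x ^ (k + m) * V * S * M * N * P * hfac

theorem vwpTerm_append_mul {K : Type*} [Field K] (a : K) (l l' : List K) (q x y : K) (n : ℕ) :
    vwpTerm a (l ++ l') q (x * y) n = vwpTerm a l q x n * (wpRatio a l' q n * y ^ n) := by
  simp only [vwpTerm, wpRatio_append, mul_pow]
  ring

theorem tsum_vwpTerm_three_shift {a e f s q x : ℂ} (hs : s ≠ 0) (he : e ≠ 0) (hf : f ≠ 0)
    (hx : a * q = e * f * x) (hq0 : q ≠ 0) (hq : ‖q‖ < 1) (hx1 : ‖x‖ < 1)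
    (ha : QRegular q (a * q)) (has : QRegular q (a * s * q))
    (hl : ∀ y ∈ [e, f], QRegular q (a * s * q / y)) (k : ℕ) :
    ∑' m, vwpTerm (a * s * q ^ (2 * k)) [e * q ^ k, f * q ^ k, s] q x m =
      qPochInf (a * s * q * q ^ (2 * k)) q * qPochInf (s * x) q /
          (qPochInf (a * q * q ^ (2 * k)) q * qPochInf x q) *
        ([e, f].map fun y =>
          qPochInf (a * q / y * q ^ k) q / qPochInf (a * s * q / y * q ^ k) q).prod := by
  have hqk := pow_ne_zero k hq0
  have hshift (y : ℂ) : a * s * q * q ^ (2 * k) / (y * q ^ k) = a * s * q / y * q ^ k := by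
    rw [two_mul, pow_add]
    field_simp
  have hbase : a * s * q ^ (2 * k) * q = a * s * q * q ^ (2 * k) := by ring
  have hlow : a * s * q * q ^ (2 * k) / s = a * q * q ^ (2 * k) := by field_simp
  have hxe : x * (e * q ^ k) = a * q / f * q ^ k := by
    rw [hx]
    field_simp
  have hxf : x * (f * q ^ k) = a * q / e * q ^ k := by
    rw [hx]
    field_simp
  rw [tsum_vwpTerm_three (mul_ne_zero he hqk) (mul_ne_zero hf hqk) hs
    (by linear_combination s * q ^ (2 * k) * hx) hq hx1 (by rw [hbase]; exact has.mul_pow _)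
    (by
      simp only [List.forall_mem_cons, hbase, hshift, hlow] at hl ⊢
      exact ⟨hl.1.mul_pow k, hl.2.1.mul_pow k, ha.mul_pow _, by simp⟩)]
  simp only [List.map_cons, List.map_nil, List.prod_cons, List.prod_nil, mul_one, hshift, hlow,
    hbase, hxe, hxf, mul_comm x s]
  ring

theorem tsum_baileyTerm_right {a b c d e f s q x : ℂ} (hs : s ≠ 0) (he : e ≠ 0) (hf : f ≠ 0)
    (hx : a * q = e * f * x) (hq0 : q ≠ 0) (hq : ‖q‖ < 1) (hx1 : ‖x‖ < 1)
    (ha : QRegular q (a * q)) (has : QRegular q (a * s * q))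
    (hl : ∀ y ∈ [e, f], QRegular q (a * q / y) ∧ QRegular q (a * s * q / y)) (k : ℕ) :
    ∑' m, baileyTerm a b c d e f s q x k m =
      qPochInf (a * s * q) q * qPochInf (s * x) q / (qPochInf (a * q) q * qPochInf x q) *
        ([e, f].map fun y => qPochInf (a * q / y) q / qPochInf (a * s * q / y) q).prod *
        vwpTerm a [b, c, d, e, f] q (s * x) k := by
  have hrow := tsum_vwpTerm_three_shift hs he hf hx hq0 hq hx1 ha has (fun y hy => (hl y hy).2) k
  simp only [List.forall_mem_cons, List.map_cons, List.map_nil, List.prod_cons, List.prod_nil,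
    mul_one] at hl hrow ⊢
  simp_rw [baileyTerm_eq_mul_vwpTerm hq0 hs (.of_norm_lt_one hq hq), tsum_mul_left, hrow]
  rw [show [b, c, d, e, f] = [b, c, d] ++ [e, f] from rfl, vwpTerm_append_mul,
    qPochInf_eq_mul (a * q) hq (2 * k), qPochInf_eq_mul (a * s * q) hq (2 * k),
    qPochInf_eq_mul (a * q / e) hq k, qPochInf_eq_mul (a * q / f) hq k,
    qPochInf_eq_mul (a * s * q / e) hq k, qPochInf_eq_mul (a * s * q / f) hq k]
  have hE := hl.1.1.qPochNat_ne_zero k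
  have hF := hl.2.1.1.qPochNat_ne_zero k
  obtain ⟨u, hu⟩ : ∃ u, qPochNat e q k = u * qPochNat (a * q / e) q k :=
    ⟨_, (div_mul_cancel₀ _ hE).symm⟩
  obtain ⟨v, hv⟩ : ∃ v, qPochNat f q k = v * qPochNat (a * q / f) q k :=
    ⟨_, (div_mul_cancel₀ _ hF).symm⟩
  simp only [wpRatio_cons, wpRatio_nil, mul_one, hu, hv, mul_div_cancel_right₀ _ hE,
    mul_div_cancel_right₀ _ hF]
  ring

theorem sum_antidiagonal_baileyTerm {a b c d e f s q x : ℂ} (hs : s ≠ 0) (hb : b ≠ 0) (hc : c ≠ 0)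
    (hd : d ≠ 0) (h : a * q = b * c * d * s) (hq : QRegular q q) (ha : QRegular q (a * q))
    (hl : ∀ y ∈ [b, c, d], QRegular q (a * q / y)) (n : ℕ) :
    ∑ p ∈ antidiagonal n, baileyTerm a b c d e f s q x p.1 p.2 =
      vwpTerm (a * s) [s * b, s * c, s * d, e, f] q x n := by
  have hcancel (y : ℂ) : a * s * q / (s * y) = a * q / y := by field_simp
  calc ∑ p ∈ antidiagonal n, baileyTerm a b c d e f s q x p.1 p.2
      = vwpTerm (a * s) [e, f] q x n *
          ∑ p ∈ antidiagonal n, jacksonTerm a b c d s q p.1 p.2 := by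
        rw [mul_sum]
        exact sum_congr rfl fun p hp => by rw [baileyTerm, mem_antidiagonal.mp hp]
    _ = vwpTerm (a * s) [s * b, s * c, s * d, e, f] q x n := by
        rw [sum_antidiagonal_jacksonTerm hb hc hd h hq ha hl]
        simp only [vwpTerm, wpRatio_cons, wpRatio_nil, hcancel, List.map_cons, List.map_nil,
          List.prod_cons, List.prod_nil]
        ring

theorem summable_baileyTerm {a b c d e f s q x : ℂ} (hq : ‖q‖ < 1) (hx : ‖x‖ < 1)
    (hsx : ‖s * x‖ < 1) (ha : QRegular q (a * q)) (hl : ∀ y ∈ [b, c, d], QRegular q (a * q / y))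
    (hl' : ∀ y ∈ [e, f], QRegular q (a * s * q / y)) :
    Summable fun p : ℕ × ℕ => baileyTerm a b c d e f s q x p.1 p.2 := by
  have hgeom := (summable_geometric_of_lt_one (norm_nonneg (s * x)) hsx).mul_of_nonneg
    (summable_geometric_of_lt_one (norm_nonneg x) hx) (fun _ => by positivity)
    (fun _ => by positivity)
  have hO := (isBigO_vwpTerm (L := ⊤) hq hl' x fun p : ℕ × ℕ => p.1 + p.2).mul
    (isBigO_jacksonTerm (s := s) hq ha hl)
  refine summable_of_isBigO hgeom ((hO.mono le_top).congr_right fun p => ?_)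
  rw [norm_mul]
  ring

theorem tsum_vwpTerm_five {a b c d e f s q x : ℂ} (hs : s ≠ 0) (hb : b ≠ 0) (hc : c ≠ 0)
    (hd : d ≠ 0) (he : e ≠ 0) (hf : f ≠ 0) (h : a * q = b * c * d * s) (hx : a * q = e * f * x)
    (hq0 : q ≠ 0) (hq : ‖q‖ < 1) (hx1 : ‖x‖ < 1) (hsx : ‖s * x‖ < 1) (ha : QRegular q (a * q))
    (has : QRegular q (a * s * q)) (hl : ∀ y ∈ [b, c, d], QRegular q (a * q / y))
    (hl' : ∀ y ∈ [e, f], QRegular q (a * q / y) ∧ QRegular q (a * s * q / y)) :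
    ∑' n, vwpTerm (a * s) [s * b, s * c, s * d, e, f] q x n =
      qPochInf (a * s * q) q * qPochInf (s * x) q / (qPochInf (a * q) q * qPochInf x q) *
        ([e, f].map fun y => qPochInf (a * q / y) q / qPochInf (a * s * q / y) q).prod *
        ∑' k, vwpTerm a [b, c, d, e, f] q (s * x) k := by
  have hsum := summable_baileyTerm hq hx1 hsx ha hl fun y hy => (hl' y hy).2
  calc ∑' n, vwpTerm (a * s) [s * b, s * c, s * d, e, f] q x n
      = ∑' n, ∑ p ∈ antidiagonal n, baileyTerm a b c d e f s q x p.1 p.2 :=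
        tsum_congr fun n =>
          (sum_antidiagonal_baileyTerm hs hb hc hd h (.of_norm_lt_one hq hq) ha hl n).symm
    _ = ∑' p : ℕ × ℕ, baileyTerm a b c d e f s q x p.1 p.2 :=
        ((HasAntidiagonal.sigmaAntidiagonalEquivProd.hasSum_iff.mpr hsum.hasSum).sigma fun n =>
          (HasAntidiagonal.antidiagonal n).hasSum fun p : ℕ × ℕ =>
            baileyTerm a b c d e f s q x p.1 p.2).tsum_eq
    _ = ∑' k, ∑' m, baileyTerm a b c d e f s q x k m := hsum.tsum_prod
    _ = _ := by
        simp_rw [tsum_baileyTerm_right hs he hf hx hq0 hq hx1 ha has hl', tsum_mul_left]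

end Bailey

section Bilateral

variable {q : ℂ}

theorem qPoch_neg_natCast (hq : q ≠ 0) {x : ℂ} (hx : x ≠ 0) (n : ℕ) :
    qPoch x q (-n) = (∏ k ∈ range n, -(q ^ (k + 1) / x)) / qPochNat (q / x) q n := by
  have hfactor (k : ℕ) :
      (1 - x * (q ^ (k + 1))⁻¹)⁻¹ = -(q ^ (k + 1) / x) / (1 - q / x * q ^ k) := by
    have hqk := pow_ne_zero (k + 1) hq
    have hswap : 1 - x * (q ^ (k + 1))⁻¹ = (1 - q / x * q ^ k) / -(q ^ (k + 1) / x) := by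
      field_simp
      ring
    rw [hswap, inv_div]
  cases n with
  | zero => simp [qPoch]
  | succ m =>
    rw [show -((m + 1 : ℕ) : ℤ) = Int.negSucc m from rfl, qPoch, ← prod_inv_distrib, qPochNat,
      ← prod_div_distrib]
    exact prod_congr rfl fun k _ => hfactor k

theorem qPoch_neg_div_qPoch_neg (hq : q ≠ 0) {a y : ℂ} (ha : a ≠ 0) (hy : y ≠ 0) (n : ℕ) :
    qPoch y q (-n) / qPoch (a * q / y) q (-n) =
      (a * q / y ^ 2) ^ n * (qPochNat (y / a) q n / qPochNat (a⁻¹ * q / (y / a)) q n) := by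
  have hprod : (∏ k ∈ range n, -(q ^ (k + 1) / y)) =
      (a * q / y ^ 2) ^ n * ∏ k ∈ range n, -(q ^ (k + 1) / (a * q / y)) := by
    rw [← card_range n, ← prod_const, card_range, ← prod_mul_distrib]
    refine prod_congr rfl fun k _ => ?_
    field_simp
  have hne : ∏ k ∈ range n, -(q ^ (k + 1) / (a * q / y)) ≠ 0 :=
    prod_ne_zero_iff.mpr fun k _ => by simp [hq, ha, hy]
  rw [qPoch_neg_natCast hq hy, qPoch_neg_natCast hq (by simp [hq, ha, hy]), hprod,
    show q / (a * q / y) = y / a by field_simp, show a⁻¹ * q / (y / a) = q / y by field_simp]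
  rw [div_div_div_eq, mul_right_comm, mul_div_mul_right _ _ hne, mul_div_assoc]

theorem qPochList_div_qPochList_map (l : List ℂ) (f : ℂ → ℂ) (q : ℂ) (n : ℤ) :
    qPochList l q n / qPochList (l.map f) q n =
      (l.map fun y => qPoch y q n / qPoch (f y) q n).prod := by
  induction l with
  | nil => simp [qPochList]
  | cons y l ih =>
    simp only [qPochList, List.map_cons, List.prod_cons] at ih ⊢
    rw [mul_div_mul_comm, ih]

theorem psiTerm_natCast (a : ℂ) (l : List ℂ) (q x : ℂ) (n : ℕ) :
    psiTerm l (l.map fun y => a * q / y) q x n = wpRatio a l q n * x ^ n := by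
  rw [psiTerm, qPochList_div_qPochList_map, zpow_natCast]
  rfl

theorem psiTerm_neg_natCast (hq : q ≠ 0) {a : ℂ} (ha : a ≠ 0) {l : List ℂ} (hl : ∀ y ∈ l, y ≠ 0)
    (x : ℂ) (n : ℕ) :
    psiTerm l (l.map fun y => a * q / y) q x (-n) =
      wpRatio a⁻¹ (l.map (· / a)) q n * ((l.map fun y => a * q / y ^ 2).prod / x) ^ n := by
  rw [psiTerm, qPochList_div_qPochList_map,
    List.map_congr_left fun y hy => qPoch_neg_div_qPoch_neg hq ha (hl y hy) n,
    List.prod_map_mul, wpRatio, List.map_map, zpow_neg, zpow_natCast, div_pow]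
  have hpow := List.prod_map_hom l (fun y => a * q / y ^ 2) (powMonoidHom n)
  simp only [Function.comp_def, powMonoidHom_apply] at hpow ⊢
  rw [hpow]
  ring

/-- The `n`-th term of either half of the bilateral series `vwpPsi a (√a :: l) q x`, where `s = √a`:
the parameters `q s, -q s, s` reduce to a factor linear in `q ^ n`. -/
def psiHalfTerm {K : Type*} [Field K] (s : K) (l : List K) (q x : K) (n : ℕ) : K :=
  (1 + s * q ^ n) / (1 + s) * (wpRatio (s ^ 2) l q n * x ^ n)

theorem psiHalfTerm_zero {K : Type*} [Field K] {s : K} (hs : 1 + s ≠ 0) (l : List K) (q x : K) :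
    psiHalfTerm s l q x 0 = 1 := by
  simp [psiHalfTerm, wpRatio, hs]

theorem wpRatio_sqrt_cons {K : Type*} [Field K] {q s : K} (hq : q ≠ 0) (hs : s ≠ 0)
    (hreg : QRegular q s) (hreg' : QRegular q (-s)) (l : List K) (n : ℕ) :
    wpRatio (s ^ 2) (q * s :: -(q * s) :: s :: l) q n =
      (1 + s * q ^ n) / (1 + s) * wpRatio (s ^ 2) l q n := by
  have hneg : qPochNat (-(q * s)) q n / qPochNat (-s) q n = (1 + s * q ^ n) / (1 + s) := by
    simpa using hreg'.qPochNat_mul_div_qPochNat n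
  have hsq : QRegular q (q * s) := by simpa [mul_comm] using hreg.mul_pow 1
  have hs0 := hreg.qPochNat_ne_zero n
  have hsq0 := hsq.qPochNat_ne_zero n
  simp only [wpRatio_cons]
  rw [show s ^ 2 * q / (q * s) = s by field_simp, show s ^ 2 * q / -(q * s) = -s by field_simp,
    show s ^ 2 * q / s = q * s by field_simp, hneg]
  field_simp

theorem complex_sq_sqrt (a : ℂ) : a.sqrt ^ 2 = a := by simp [Complex.sqrt]

theorem complex_sqrt_ne_zero {a : ℂ} (ha : a ≠ 0) : a.sqrt ≠ 0 := by
  rwa [← sq_eq_zero_iff.ne, complex_sq_sqrt]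

theorem vwpPsiTerm_sqrt_cons {a : ℂ} (hq : q ≠ 0) (ha : a ≠ 0) (l : List ℂ) (x : ℂ) :
    vwpPsiTerm a (a.sqrt :: l) q x =
      psiTerm (q * a.sqrt :: -(q * a.sqrt) :: a.sqrt :: l)
        ((q * a.sqrt :: -(q * a.sqrt) :: a.sqrt :: l).map fun y => a * q / y) q x := by
  have hs := complex_sqrt_ne_zero ha
  have hsq := complex_sq_sqrt a
  have h : a * q / (q * a.sqrt) = a.sqrt := by
    field_simp
    exact hsq.symm
  ext n
  simp only [vwpPsiTerm, List.map_cons, div_neg, h]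

theorem vwpPsiTerm_sqrt_cons_natCast {a : ℂ} (hq : q ≠ 0) (ha : a ≠ 0) (hreg : QRegular q a.sqrt)
    (hreg' : QRegular q (-a.sqrt)) (l : List ℂ) (x : ℂ) (n : ℕ) :
    vwpPsiTerm a (a.sqrt :: l) q x n = psiHalfTerm a.sqrt l q x n := by
  have hs := complex_sqrt_ne_zero ha
  have hsq := complex_sq_sqrt a
  have h := wpRatio_sqrt_cons hq hs hreg hreg' l n
  rw [hsq] at h
  rw [vwpPsiTerm_sqrt_cons hq ha, psiTerm_natCast, h, psiHalfTerm, hsq, mul_assoc]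

theorem vwpPsiTerm_sqrt_cons_neg_natCast {a : ℂ} (hq : q ≠ 0) (ha : a ≠ 0)
    (hreg : QRegular q a.sqrt⁻¹) (hreg' : QRegular q (-a.sqrt⁻¹)) {l : List ℂ} (hl : ∀ y ∈ l, y ≠ 0)
    (x : ℂ) (n : ℕ) :
    vwpPsiTerm a (a.sqrt :: l) q x (-n) =
      psiHalfTerm a.sqrt⁻¹ (l.map (· / a)) q ((l.map fun y => a * q / y ^ 2).prod / (q * x)) n := by
  have hs := complex_sqrt_ne_zero ha
  have hsq := complex_sq_sqrt a
  have hinv : a.sqrt / a = a.sqrt⁻¹ := by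
    nth_rw 2 [← hsq]
    field_simp
  have h := wpRatio_sqrt_cons hq (inv_ne_zero hs) hreg hreg' (l.map (· / a)) n
  rw [inv_pow, hsq] at h
  rw [vwpPsiTerm_sqrt_cons hq ha, psiTerm_neg_natCast hq ha (by simpa [hq, hs] using hl),
    List.map_cons, List.map_cons, List.map_cons, neg_div, mul_div_assoc, hinv, h, psiHalfTerm,
    inv_pow, hsq, mul_assoc]
  congr 3
  simp only [List.map_cons, List.prod_cons, neg_sq, mul_pow, hsq]
  field_simp

theorem vwpTerm_one_succ (hq : QRegular q q) (l : List ℂ) (x : ℂ) (n : ℕ) :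
    vwpTerm 1 l q x (n + 1) = 2 * psiHalfTerm 1 l q x (n + 1) := by
  have h := hq.qPochNat_ne_zero n
  have h' := hq.one_sub_ne_zero n
  rw [vwpTerm, psiHalfTerm, vwpFac, one_pow, qPochNat_succ q, one_mul]
  field_simp
  ring

end Bilateral

section BilateralLimit

variable {q : ℂ} {ι : Type*} {L : Filter ι} {s u x : ι → ℂ} {x₀ : ℂ} {l : List ℂ}

theorem isBigO_psiHalfTerm {r : ℝ} (hq : ‖q‖ < 1) (hs : Tendsto s L (𝓝 1))
    (hu : Tendsto u L (𝓝 1)) (hxr : ∀ᶠ i in L, ‖x i‖ ≤ r) (hl : ∀ y ∈ l, y ≠ 0)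
    (hreg : ∀ y ∈ l, QRegular q (q / y)) :
    (fun p : ι × ℕ => psiHalfTerm (s p.1) (l.map (· * u p.1)) q (x p.1) p.2) =O[L ×ˢ ⊤]
      fun p => r ^ p.2 := by
  have hs' : Tendsto (fun p : ι × ℕ => s p.1) (L ×ˢ ⊤) (𝓝 1) := hs.comp tendsto_fst
  have hu' : Tendsto (fun p : ι × ℕ => u p.1) (L ×ˢ ⊤) (𝓝 1) := hu.comp tendsto_fst
  have hnum := (isBigO_const_one ℝ (1 : ℂ) _).add
    (isBigO_mul_pow_one hq (hs'.isBigO_one ℝ) Prod.snd)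
  have hden := (((tendsto_const_nhds (x := (1 : ℂ))).add hs').inv₀ (by norm_num)).isBigO_one ℝ
  have hratio := isBigO_wpRatio (a := fun p : ι × ℕ => s p.1 ^ 2)
    (l := l.map fun y p => y * u p.1) hq
    (List.forall_mem_map.mpr fun y _ => (hu'.const_mul y).isBigO_one ℝ)
    (List.forall_mem_map.mpr fun y hy => ⟨q / y, by
      simpa [Pi.div_def] using
        ((hs'.pow 2).mul_const q).div (hu'.const_mul y) (by simpa using hl y hy),
      hreg y hy⟩) Prod.snd
  have hpow : (fun p : ι × ℕ => x p.1 ^ p.2) =O[L ×ˢ ⊤] fun p => r ^ p.2 := by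
    refine .of_bound 1 ((tendsto_fst.eventually hxr).mono fun p hp => ?_)
    rw [one_mul, norm_pow]
    exact (pow_le_pow_left₀ (norm_nonneg _) hp _).trans (Real.le_norm_self _)
  simpa only [psiHalfTerm, List.map_map, Function.comp_def, div_eq_mul_inv, one_mul] using
    (hnum.mul hden).mul (hratio.mul hpow)

theorem tendsto_psiHalfTerm (hs : Tendsto s L (𝓝 1)) (hu : Tendsto u L (𝓝 1))
    (hx : Tendsto x L (𝓝 x₀)) (hl : ∀ y ∈ l, y ≠ 0) (hreg : ∀ y ∈ l, QRegular q (q / y)) (n : ℕ) :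
    Tendsto (fun i => psiHalfTerm (s i) (l.map (· * u i)) q (x i) n) L
      (𝓝 (psiHalfTerm 1 l q x₀ n)) := by
  have hratio : Tendsto (fun i => wpRatio (s i ^ 2) (l.map (· * u i)) q n) L
      (𝓝 (wpRatio (1 ^ 2) l q n)) := by
    simp only [wpRatio, List.map_map, Function.comp_def]
    refine tendsto_list_prod _ fun y hy => ?_
    have hnum := ((continuous_qPochNat q n).tendsto _).comp (hu.const_mul y)
    have hden := ((continuous_qPochNat q n).tendsto _).comp
      (((hs.pow 2).mul_const q).div (hu.const_mul y) (by simpa using hl y hy))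
    simp only [mul_one, one_pow, one_mul] at hnum hden ⊢
    exact hnum.div hden ((hreg y hy).qPochNat_ne_zero n)
  exact (((hs.mul_const _).const_add 1).div (hs.const_add 1) (by norm_num)).mul
    (hratio.mul (hx.pow n))

theorem tendsto_tsum_psiHalfTerm (hq : ‖q‖ < 1) (hs : Tendsto s L (𝓝 1)) (hu : Tendsto u L (𝓝 1))
    (hx : Tendsto x L (𝓝 x₀)) (hx₀ : ‖x₀‖ < 1) (hl : ∀ y ∈ l, y ≠ 0)
    (hreg : ∀ y ∈ l, QRegular q (q / y)) :
    (∀ᶠ i in L, Summable (psiHalfTerm (s i) (l.map (· * u i)) q (x i))) ∧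
      Tendsto (fun i => ∑' n, psiHalfTerm (s i) (l.map (· * u i)) q (x i) n) L
        (𝓝 (∑' n, psiHalfTerm 1 l q x₀ n)) := by
  obtain ⟨r, hr, hr1⟩ := exists_between hx₀
  have hr0 : 0 ≤ r := (norm_nonneg _).trans hr.le
  obtain ⟨C, hC⟩ := (isBigO_psiHalfTerm hq hs hu
    ((hx.norm.eventually_lt_const hr).mono fun _ => le_of_lt) hl hreg).bound
  have hgeom := (summable_geometric_of_lt_one hr0 hr1).mul_left C
  have hbound : ∀ᶠ i in L, ∀ n, ‖psiHalfTerm (s i) (l.map (· * u i)) q (x i) n‖ ≤ C * r ^ n := by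
    filter_upwards [mem_prod_top.mp hC] with i hi n
    simpa [abs_of_nonneg hr0] using hi n
  exact ⟨hbound.mono fun i hi => hgeom.of_norm_bounded hi,
    tendsto_tsum_of_dominated_convergence hgeom (tendsto_psiHalfTerm hs hu hx hl hreg) hbound⟩

theorem eventually_qRegular (hq : ‖q‖ < 1) (hs : Tendsto s L (𝓝 1)) (hne : ∀ᶠ i in L, s i ≠ 1) :
    ∀ᶠ i in L, QRegular q (s i) ∧ QRegular q (-s i) := by
  have hsq : ∀ᶠ i in L, ‖s i * q‖ < 1 := (hs.mul_const q).norm.eventually_lt_const (by simpa)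
  filter_upwards [hsq, hne, hs.eventually_ne (show (1 : ℂ) ≠ -1 by norm_num)] with i hi h1 h2
  constructor
  · rintro (_ | k)
    · simpa using h1
    · rw [pow_succ', ← mul_assoc]
      exact QRegular.of_norm_lt_one hq hi k
  · rintro (_ | k)
    · rw [pow_zero, mul_one]
      exact fun h => h2 (neg_eq_iff_eq_neg.mp h)
    · rw [pow_succ', ← mul_assoc]
      exact QRegular.of_norm_lt_one hq (by rwa [neg_mul, norm_neg]) k

theorem tsum_vwpTerm_one (hq : ‖q‖ < 1) (hx₀ : ‖x₀‖ < 1) (hl : ∀ y ∈ l, y ≠ 0)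
    (hreg : ∀ y ∈ l, QRegular q (q / y)) :
    ∑' n, vwpTerm 1 l q x₀ n = 2 * ∑' n, psiHalfTerm 1 l q x₀ n - 1 := by
  have hhalf : Summable (psiHalfTerm 1 l q x₀) := by
    simpa using (tendsto_tsum_psiHalfTerm (L := pure ()) hq tendsto_const_nhds
      (tendsto_const_nhds (x := 1)) tendsto_const_nhds hx₀ hl hreg).1
  have hvwp : Summable (vwpTerm 1 l q x₀) :=
    summable_vwpTerm hq (by simpa using hreg) hx₀
  rw [hvwp.tsum_eq_zero_add, hhalf.tsum_eq_zero_add]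
  simp only [vwpTerm_one_succ (QRegular.of_norm_lt_one hq hq), tsum_mul_left,
    psiHalfTerm_zero (show (1 + 1 : ℂ) ≠ 0 by norm_num)]
  simp [vwpTerm, vwpFac, wpRatio]
  ring

theorem hasSum_vwpPsiTerm_sqrt_cons {a x : ℂ} (hq : q ≠ 0) (ha : a ≠ 0)
    (hreg : QRegular q a.sqrt ∧ QRegular q (-a.sqrt))
    (hreg' : QRegular q a.sqrt⁻¹ ∧ QRegular q (-a.sqrt⁻¹)) (hl : ∀ y ∈ l, y ≠ 0)
    (hpos : Summable (psiHalfTerm a.sqrt l q x))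
    (hneg : Summable (psiHalfTerm a.sqrt⁻¹ (l.map (· / a)) q
      ((l.map fun y => a * q / y ^ 2).prod / (q * x)))) :
    HasSum (vwpPsiTerm a (a.sqrt :: l) q x)
      (∑' n, psiHalfTerm a.sqrt l q x n + ∑' n, psiHalfTerm a.sqrt⁻¹ (l.map (· / a)) q
        ((l.map fun y => a * q / y ^ 2).prod / (q * x)) n - 1) := by
  have hpos : HasSum (fun n => psiHalfTerm a.sqrt l q x n) _ := hpos.hasSum
  have hneg : HasSum (fun n => psiHalfTerm a.sqrt⁻¹ (l.map (· / a)) q _ n) _ := hneg.hasSum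
  have hzero := vwpPsiTerm_sqrt_cons_natCast hq ha hreg.1 hreg.2 l x 0
  rw [psiHalfTerm_zero (by simpa using hreg.2.one_sub_ne_zero 0), Nat.cast_zero] at hzero
  simp only [← vwpPsiTerm_sqrt_cons_natCast hq ha hreg.1 hreg.2,
    ← vwpPsiTerm_sqrt_cons_neg_natCast hq ha hreg'.1 hreg'.2 hl] at hpos hneg ⊢
  rw [← hzero]
  exact hpos.of_nat_of_neg hneg

theorem tendsto_vwpPsi_sqrt_cons {x : ℂ} (hq0 : q ≠ 0) (hq : ‖q‖ < 1) (hl : ∀ y ∈ l, y ≠ 0)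
    (hreg : ∀ y ∈ l, QRegular q (q / y)) (hx : ‖x‖ < 1)
    (hbal : (l.map fun y => q / y ^ 2).prod = q * x ^ 2) :
    (∀ᶠ a in 𝓝[≠] 1, Summable (vwpPsiTerm a (a.sqrt :: l) q x)) ∧
      Tendsto (fun a => vwpPsi a (a.sqrt :: l) q x) (𝓝[≠] 1) (𝓝 (∑' n, vwpTerm 1 l q x n)) := by
  have ha : Tendsto (fun a : ℂ => a) (𝓝[≠] 1) (𝓝 1) := tendsto_id.mono_left nhdsWithin_le_nhds
  have hs : Tendsto Complex.sqrt (𝓝[≠] 1) (𝓝 1) := by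
    simpa [Function.comp_def] using
      (Complex.continuousAt_sqrt (z := 1) (by simp)).tendsto.comp ha
  have hs' : Tendsto (fun a : ℂ => a.sqrt⁻¹) (𝓝[≠] 1) (𝓝 1) := by simpa using hs.inv₀ one_ne_zero
  have hu' : Tendsto (fun a : ℂ => a⁻¹) (𝓝[≠] 1) (𝓝 1) := by simpa using ha.inv₀ one_ne_zero
  have hne : ∀ᶠ a : ℂ in 𝓝[≠] 1, a.sqrt ≠ 1 := by
    filter_upwards [self_mem_nhdsWithin] with a h1 h
    exact h1 (by simpa [h] using (complex_sq_sqrt a).symm)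
  have hx' : Tendsto (fun a : ℂ => (l.map fun y => a * q / y ^ 2).prod / (q * x))
      (𝓝[≠] 1) (𝓝 x) := by
    have h : Tendsto (fun a : ℂ => (l.map fun y => a * q / y ^ 2).prod) (𝓝[≠] 1)
        (𝓝 (l.map fun y => q / y ^ 2).prod) :=
      tendsto_list_prod _ fun y _ => by simpa using (ha.mul_const q).div_const (y ^ 2)
    have hlim : (l.map fun y => q / y ^ 2).prod / (q * x) = x := by
      rw [hbal, sq, ← mul_assoc]
      exact mul_div_cancel_left_of_imp fun h => (mul_eq_zero.mp h).resolve_left hq0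
    simpa only [hlim] using h.div_const (q * x)
  obtain ⟨hsum, hlim⟩ := tendsto_tsum_psiHalfTerm (u := fun _ => 1) hq hs tendsto_const_nhds
    (tendsto_const_nhds (x := x)) hx hl hreg
  obtain ⟨hsum', hlim'⟩ := tendsto_tsum_psiHalfTerm hq hs' hu' hx' hx hl hreg
  simp only [mul_one, List.map_id', ← div_eq_mul_inv] at hsum hlim hsum' hlim'
  have hhas : ∀ᶠ a in 𝓝[≠] 1, HasSum (vwpPsiTerm a (a.sqrt :: l) q x)
      (∑' n, psiHalfTerm a.sqrt l q x n + ∑' n, psiHalfTerm a.sqrt⁻¹ (l.map (· / a)) q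
        ((l.map fun y => a * q / y ^ 2).prod / (q * x)) n - 1) := by
    filter_upwards [hsum, hsum', ha.eventually_ne one_ne_zero, eventually_qRegular hq hs hne,
      eventually_qRegular hq hs' (hne.mono fun a h => by simpa using h)] with a h h' ha0 hr hr'
    exact hasSum_vwpPsiTerm_sqrt_cons hq0 ha0 hr hr' hl h h'
  refine ⟨hhas.mono fun a h => h.summable, ?_⟩
  rw [tsum_vwpTerm_one hq hx hl hreg, two_mul]
  exact ((hlim.add hlim').sub_const 1).congr' (hhas.mono fun a h => h.tsum_eq.symm)

end BilateralLimit

section VeryWellPoised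

variable {a q x : ℂ} {l : List ℂ}

theorem vwpWTerm_eq_mul_wpRatio (a : ℂ) (l : List ℂ) (q x : ℂ) (n : ℕ) :
    vwpWTerm a l q x n =
      qPochNat a q n * (qPochNat (q * a.sqrt) q n / qPochNat a.sqrt q n) *
        (qPochNat (-(q * a.sqrt)) q n / qPochNat (-a.sqrt) q n) / qPochNat q q n *
          wpRatio a l q n * x ^ n := by
  have h : qPochList l q n / qPochList (l.map fun y => a * q / y) q n = wpRatio a l q n :=
    qPochList_div_qPochList_map l _ q n
  rw [vwpWTerm, phiTerm, ← h]
  simp only [qPochList, List.map_cons, List.prod_cons]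
  change _ = qPoch a q n * (qPoch (q * a.sqrt) q n / qPoch a.sqrt q n) *
    (qPoch (-(q * a.sqrt)) q n / qPoch (-a.sqrt) q n) / qPoch q q n * _ * _
  simp only [div_eq_mul_inv, mul_inv]
  ring

theorem vwpWTerm_eq_vwpTerm (h : ∀ k : ℕ, a * q ^ (2 * k) ≠ 1) (l : List ℂ) (x : ℂ) :
    vwpWTerm a l q x = vwpTerm a l q x := by
  have hreg {s : ℂ} (hs : s ^ 2 = a) : QRegular q s := fun k hk => h k (by
    rw [← hs, mul_comm 2, pow_mul, ← mul_pow, hk, one_pow])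
  have ha : 1 - a ≠ 0 := sub_ne_zero.mpr fun h1 => h 0 (by simp [← h1])
  have hsq := complex_sq_sqrt a
  ext n
  have hfac := one_sub_mul_vwpFac a q n
  rw [vwpWTerm_eq_mul_wpRatio, vwpTerm, (hreg hsq).qPochNat_mul_div_qPochNat, ← mul_neg,
    (hreg (by rwa [neg_sq])).qPochNat_mul_div_qPochNat, mul_assoc (qPochNat a q n),
    div_mul_div_comm, show (1 - a.sqrt) * (1 - -a.sqrt) = 1 - a by linear_combination -hsq,
    show (1 - a.sqrt * q ^ n) * (1 - -a.sqrt * q ^ n) = 1 - a * q ^ (2 * n) by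
      linear_combination -q ^ (2 * n) * hsq, mul_div_assoc', mul_comm (qPochNat a q n), ← hfac,
    mul_div_cancel_left₀ _ ha]

theorem vwpWTerm_one_eq_vwpTerm (h : 1 ∈ l) (q x : ℂ) : vwpWTerm 1 l q x = vwpTerm 1 l q x := by
  ext n
  rw [vwpWTerm_eq_mul_wpRatio, vwpTerm]
  cases n with
  | zero => simp [vwpFac]
  | succ n =>
    have hone : qPochNat (1 : ℂ) q (n + 1) = 0 := by simp [qPochNat_succ']
    have hratio : wpRatio 1 l q (n + 1) = 0 :=
      List.prod_eq_zero (List.mem_map.mpr ⟨1, h, by rw [hone, zero_div]⟩)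
    simp [hratio]

end VeryWellPoised

theorem QRegular.div_of_ne_pow {K : Type*} [Field K] {q y : K} (h : ∀ j : ℕ, y ≠ q ^ (j + 1)) :
    QRegular q (q / y) := fun k hk => by
  have hy : y ≠ 0 := by rintro rfl; simp at hk
  exact h k (by rw [div_mul_eq_mul_div, div_eq_one_iff_eq hy] at hk; rw [pow_succ', hk])

section Specialization

variable {q c d e z : ℂ}

theorem QRegular.div_sq (hq : ‖q‖ < 1) (hz : z ≠ 0) (hqz : ‖q / z‖ < 1) (hz2 : z ^ 2 ≠ q) :
    QRegular q (q / z ^ 2) := by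
  rintro (_ | k)
  · rw [pow_zero, mul_one, ne_eq, div_eq_one_iff_eq (pow_ne_zero 2 hz)]
    exact hz2.symm
  · have hnorm : ‖q / z * (q / z)‖ < 1 := by
      rw [norm_mul]
      exact mul_lt_one_of_nonneg_of_lt_one_left (norm_nonneg _) hqz hqz.le
    rw [show q / z ^ 2 * q ^ (k + 1) = q / z * (q / z) * q ^ k by field_simp; ring]
    exact QRegular.of_norm_lt_one hq hnorm k

theorem qRegular_one_div_mul_div (hq : ‖q‖ < 1) (hz : z ≠ 0) (hqz : ‖q / z‖ < 1) (hz2 : z ^ 2 ≠ q)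
    (hreg : ∀ y ∈ [c, d, e], QRegular q (q / y)) :
    ∀ y ∈ [c / z, d / z, e / z, 1 / z, z], QRegular q (1 / z * q / y) := by
  have hdiv (y : ℂ) : 1 / z * q / (y / z) = q / y := by field_simp
  have hdivz : 1 / z * q / z = q / z ^ 2 := by field_simp
  simp only [List.forall_mem_cons, hdiv, hdivz, div_one] at hreg ⊢
  exact ⟨hreg.1, hreg.2.1, hreg.2.2.1, .of_norm_lt_one hq hq, .div_sq hq hz hqz hz2, by simp⟩

theorem tsum_vwpTerm_one_div (hq0 : q ≠ 0) (hq : ‖q‖ < 1) (hc : c ≠ 0) (hd : d ≠ 0) (he : e ≠ 0)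
    (hz : z ≠ 0) (h : c * d * e = z * q) (hqz : ‖q / z‖ < 1) (hz2 : z ^ 2 ≠ q)
    (hreg : ∀ y ∈ [c, d, e], QRegular q (q / y)) (hzq : QRegular q (z * q)) :
    ∑' n, vwpTerm (1 / z) [c / z, d / z, e / z, 1 / z, z] q q n =
      qPochInf (z * q) q / qPochInf (q / z ^ 2) q * (qPochInf (q / z) q ^ 3 / qPochInf q q ^ 3) *
        ∑' n, vwpTerm 1 [c, d, e, 1 / z, z] q (q / z) n := by
  have hregq : QRegular q q := .of_norm_lt_one hq hq
  have hregqz : QRegular q (q / z) := .of_norm_lt_one hq hqz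
  have hregW := qRegular_one_div_mul_div hq hz hqz hz2 hreg
  have hone : 1 / z * z = 1 := one_div_mul_cancel hz
  have haq : 1 / z * q = q / z := one_div_mul_eq_div z q
  have hdivz : q / z / z = q / z ^ 2 := by rw [div_div, sq]
  have hqq : q / z / (1 / z) = q := by field_simp
  have hqdiv : q / (1 / z) = z * q := by field_simp
  simp only [List.forall_mem_cons] at hregW
  have hbailey := tsum_vwpTerm_five (a := 1 / z) (b := c / z) (c := d / z) (d := e / z)
    (e := 1 / z) (f := z) (s := z) (x := q / z) (q := q) hz (div_ne_zero hc hz)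
    (div_ne_zero hd hz) (div_ne_zero he hz) (one_div_ne_zero hz) hz
    (by field_simp; linear_combination -h) (by field_simp) hq0 hq hqz
    (by rwa [mul_div_cancel₀ _ hz]) (by rwa [haq]) (by rwa [hone, one_mul])
    (by simp only [List.forall_mem_cons]; exact ⟨hregW.1, hregW.2.1, hregW.2.2.1, by simp⟩)
    (by
      simp only [List.forall_mem_cons, hone, one_mul, hqdiv]
      exact ⟨⟨hregW.2.2.2.1, hzq⟩, ⟨hregW.2.2.2.2.1, hregqz⟩, by simp⟩)
  simp only [hone, mul_div_cancel₀ _ hz, one_mul, haq, hqdiv, hdivz, hqq, List.map_cons,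
    List.map_nil, List.prod_cons, List.prod_nil, mul_one] at hbailey
  rw [hbailey]
  have h1 := qPochInf_ne_zero hq hregq
  have h2 := qPochInf_ne_zero hq hregqz
  have h3 := qPochInf_ne_zero hq hzq
  have h4 := qPochInf_ne_zero hq (QRegular.div_sq hq hz hqz hz2)
  field_simp

theorem vwpWTerm_one_div_eq_vwpTerm (hq : ‖q‖ < 1) (hqz : ‖q / z‖ < 1) {l : List ℂ} (hl : z ∈ l)
    (x : ℂ) : vwpWTerm (1 / z) l q x = vwpTerm (1 / z) l q x := by
  rcases eq_or_ne z 1 with rfl | hz1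
  · rw [div_one]
    exact vwpWTerm_one_eq_vwpTerm hl q x
  · refine vwpWTerm_eq_vwpTerm (fun k => ?_) l x
    cases k with
    | zero => simpa using hz1
    | succ k =>
      rw [show 1 / z * q ^ (2 * (k + 1)) = q / z * q ^ (2 * k + 1) by ring]
      exact QRegular.of_norm_lt_one hq hqz _

end Specialization

theorem mainTheorem11 (q c d e z : ℂ) (hq0 : 0 < ‖q‖) (hq1 : ‖q‖ < 1)
    (hc0 : c ≠ 0) (hd0 : d ≠ 0) (he0 : e ≠ 0)
    (hz : z = c * d * e / q) (hqz : ‖q / z‖ < 1)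
    -- no denominator factor vanishes
    (hc : ∀ j : ℕ, c ≠ q ^ (j + 1)) (hd : ∀ j : ℕ, d ≠ q ^ (j + 1))
    (he : ∀ j : ℕ, e ≠ q ^ (j + 1)) (hzq : ∀ j : ℕ, 1 / z ≠ q ^ (j + 1))
    (hz2 : z ^ 2 ≠ q) :
    Summable (vwpWTerm (1 / z) [c / z, d / z, e / z, 1 / z, z] q q) ∧
    (∀ᶠ a in 𝓝[≠] (1 : ℂ),
      Summable (vwpPsiTerm a [Complex.sqrt a, c, d, e, 1 / z, z] q (q / z))) ∧
    ∃ L : ℂ,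
      Tendsto (fun a : ℂ => vwpPsi a [Complex.sqrt a, c, d, e, 1 / z, z] q (q / z))
        (𝓝[≠] 1) (𝓝 L) ∧
      vwpW (1 / z) [c / z, d / z, e / z, 1 / z, z] q q =
        qPochInf (z * q) q / qPochInf (q / z ^ 2) q *
          (qPochInf (q / z) q ^ 3 / qPochInf q q ^ 3) * L := by
  have hq : q ≠ 0 := norm_pos_iff.mp hq0
  have hz0 : z ≠ 0 := hz ▸ div_ne_zero (mul_ne_zero (mul_ne_zero hc0 hd0) he0) hq
  have hcde : c * d * e = z * q := by rw [hz, div_mul_cancel₀ _ hq]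
  have hreg : ∀ y ∈ [c, d, e], QRegular q (q / y) := by
    simpa using ⟨QRegular.div_of_ne_pow hc, QRegular.div_of_ne_pow hd, QRegular.div_of_ne_pow he⟩
  have hreg' : QRegular q (z * q) := by simpa [mul_comm] using QRegular.div_of_ne_pow hzq
  have hbal : ([c, d, e, 1 / z, z].map fun y => q / y ^ 2).prod = q * (q / z) ^ 2 := by
    simp only [List.map_cons, List.map_nil, List.prod_cons, List.prod_nil]
    field_simp
    linear_combination -(c * d * e + z * q) * hcde
  obtain ⟨hsum, hlim⟩ := tendsto_vwpPsi_sqrt_cons (l := [c, d, e, 1 / z, z]) hq hq1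
    (by simp [hc0, hd0, he0, hz0])
    (by simpa [mul_comm q z, hreg', QRegular.of_norm_lt_one hq1 hqz] using hreg) hqz hbal
  rw [vwpW, vwpWTerm_one_div_eq_vwpTerm hq1 hqz (by simp),
    tsum_vwpTerm_one_div hq hq1 hc0 hd0 he0 hz0 hcde hqz hz2 hreg hreg']
  exact ⟨summable_vwpTerm hq1 (qRegular_one_div_mul_div hq1 hz0 hqz hz2 hreg) hq1,
    hsum, _, hlim, rfl⟩
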